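/- Let $S$ be a countable set with the $\sigma$-algebra $2^S$, let $\mu$ be a probability measure on $S$, $P$ a transition probability kernel on $S$, and let $\Phi=(\Phi_0,\Phi_1,\dots)$ be a time-homogeneous Markov chain with initial distribution $\mu$ and transition kernel $P$, defined on a probability space with probability measure $\mathsf P_\mu$; that is, for all $n$ and $C_0,\dots,C_n\subseteq S$, $$\mathsf P_\mu(\Phi_0\in C_0,\dots,\Phi_n\in C_n)=\int_{C_0}\mu(\mathrm ds_0)\int_{C_1}P(s_0,\mathrm ds_1)\cdots\int_{C_n}P(s_{n-1},\mathrm ds_n).$$ Let $(A_1,B_1),\dots,(A_k,B_k)$ be pairs of subsets of $S$. Write $\mathrm{Fin}(A)$ and $\mathrm{Inf}(A)$ for the events that $\Phi_n\in A$ for only finitely many $n$, respectively for infinitely many $n$. For $V:S\to\mathbb R_{\ge 0}$ write $PV(s)=\int_S V(u)\,P(s,\mathrm du)$ and $\mu V=\int_S V\,\mathrm d\mu$. **Theorem (Proof Rule \#2 is $\varepsilon$-complete).** Suppose that $$\mathsf P_\mu\Big(\bigcap_{i=1}^k \mathrm{Fin}(A_i)\cup \mathrm{Inf}(B_i)\Big)=p\quad\text{for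 some } p\in(0,1].$$ Then for every $\varepsilon>0$ there exist a set $I\subseteq S$, a function $V_0:S\to\mathbb R_{\ge 0}$, and, for $i=1,\dots,k$, sets $J_i\subseteq I\smallsetminus A_i$, functions $V_i,W_i:S\to\mathbb R_{\ge 0}$, $d_i:\mathbb R_{\ge 0}\to\mathbb R_{>0}$ and $p_i:\mathbb R_{\ge 0}\to(0,1]$, such that $PV_0$, $PV_i$ and $PW_i$ are finite everywhere on $S$, such that the following conditions (Proof Rule \#2) hold, and such that $\mu V_0\le 1-p+\varepsilon$. 1. (Qualitative safety) For every $i$: $PV_i(s)\le V_i(s)$ for all $s\notin A_i$; $V_i(s)\ge 1$ for all $s\in A_i$; and there is $\gamma_i>0$ with $V_i(s)\le 1-\gamma_i$ for all $s\in J_i$. 2. (Almost-sure termination) For every $i$: - $W_i(s)>0$ and $PW_i(s)\le W_i(s)$ for all $s\in I\smallsetminus(B_i\cup J_i)$; - $W_i(s)=0$ for all $s\in I\cap(B_i\cup J_i)$; - for all real $r>0$ and all $s\in I\smallsetminus(B_i\cup J_i)$ with $W_i(s)=r$, $P\big(s,\{s':W_i(s')\le r-d_i(r)\}\big)\ge p_i(r)$;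 - $p_i$ and $d_i$ are non-increasing on $(0,\infty)$. 3. (Quantitative safety) $PV_0(s)\le V_0(s)$ for all $s\in I$, and $V_0(s)\ge 1$ for all $s\notin I$. -/

import Mathlib

open MeasureTheory ProbabilityTheory
open scoped NNReal ENNReal

noncomputable section

/-- The iterated integral
`∫_{s₁ ∈ A 0} P(s, ds₁) ∫_{s₂ ∈ A 1} P(s₁, ds₂) ⋯ ∫_{sₙ ∈ A (n-1)} P(sₙ₋₁, dsₙ)`
(equal to `1` for `n = 0`): the probability that the `n` states following `s` lie in
`A 0, …, A (n-1)` respectively. -/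
def iterKernelProb {S : Type*} [MeasurableSpace S] (P : Kernel S S) :
    ℕ → (ℕ → Set S) → S → ℝ≥0∞
  | 0, _, _ => 1
  | n + 1, A, s => ∫⁻ t in A 0, iterKernelProb P n (fun i => A (i + 1)) t ∂(P s)

/-- The process `Φ` on `(Ω, Pr)` is a time-homogeneous Markov chain with initial distribution `μ`
and transition kernel `P`: for all `n` and all measurable `A 0, …, A n`,
`Pr(Φ₀ ∈ A 0, …, Φₙ ∈ A n) = ∫_{s₀ ∈ A 0} ⋯ ∫_{sₙ ∈ A n} μ(ds₀) P(s₀, ds₁) ⋯ P(sₙ₋₁, dsₙ)`. -/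
structure IsHomogeneousMarkovChain {S Ω : Type*} [MeasurableSpace S] [MeasurableSpace Ω]
    (μ : Measure S) (P : Kernel S S) (Pr : Measure Ω) (Φ : ℕ → Ω → S) : Prop where
  measurable : ∀ n, Measurable (Φ n)
  finite_dim : ∀ (n : ℕ) (A : ℕ → Set S), (∀ i, MeasurableSet (A i)) →
    Pr {ω | ∀ i ≤ n, Φ i ω ∈ A i}
      = ∫⁻ s in A 0, iterKernelProb P n (fun i => A (i + 1)) s ∂μ

/-- The event that the process visits `A` only finitely often. -/
def finVisits {S Ω : Type*} (Φ : ℕ → Ω → S) (A : Set S) : Set Ω :=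
  ⋃ n : ℕ, ⋂ m ≥ n, {ω | Φ m ω ∉ A}

/-- The event that the process visits `A` infinitely often. -/
def infVisits {S Ω : Type*} (Φ : ℕ → Ω → S) (A : Set S) : Set Ω :=
  ⋂ n : ℕ, ⋃ m ≥ n, {ω | Φ m ω ∈ A}

/-- The reactivity event of the Streett acceptance condition `(A i, B i)`, `i = 1, …, k`. -/
def reactivity {S Ω : Type*} {k : ℕ} (Φ : ℕ → Ω → S) (A B : Fin k → Set S) : Set Ω :=
  ⋂ i, (finVisits Φ (A i) ∪ infVisits Φ (B i))

/-- The post-expectation `P V (s) = ∫ V(u) P(s, du)`, as an extended nonnegative real. -/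
def postExp {S : Type*} [MeasurableSpace S] (P : Kernel S S) (V : S → ℝ≥0) (s : S) : ℝ≥0∞ :=
  ∫⁻ u, (V u : ℝ≥0∞) ∂(P s)

/-- The init-expectation `μ V = ∫ V(s) μ(ds)`, as an extended nonnegative real. -/
def initExp {S : Type*} [MeasurableSpace S] (μ : Measure S) (V : S → ℝ≥0) : ℝ≥0∞ :=
  ∫⁻ s, (V s : ℝ≥0∞) ∂μ

/-- The proof rule for the Streett acceptance condition `(A i, B i)`: the conditions on a supporting
invariant `I` with certificate `V₀`, absorbing regions `J i`, supermartingale certificates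
`V i, W i`, decrease functions `d i : ℝ≥0 → (0, ∞)` and probability functions
`p i : ℝ≥0 → (0, 1]`. -/
structure ProofRule2 {S : Type*} [MeasurableSpace S] {k : ℕ} (P : Kernel S S)
    (A B : Fin k → Set S) (I : Set S) (V₀ : S → ℝ≥0) (J : Fin k → Set S)
    (V W : Fin k → S → ℝ≥0) (d p : Fin k → ℝ≥0 → ℝ) : Prop where
  absorbing_subset : ∀ i, J i ⊆ I \ A i
  d_pos : ∀ i r, 0 < d i r
  p_pos : ∀ i r, 0 < p i r
  p_le_one : ∀ i r, p i r ≤ 1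
  -- The post-expectations are real-valued.
  post_V₀_ne_top : ∀ s, postExp P V₀ s ≠ ∞
  post_V_ne_top : ∀ i s, postExp P (V i) s ≠ ∞
  post_W_ne_top : ∀ i s, postExp P (W i) s ≠ ∞
  -- Qualitative safety.
  post_V_le : ∀ i, ∀ s ∉ A i, postExp P (V i) s ≤ V i s
  one_le_V : ∀ i, ∀ s ∈ A i, 1 ≤ V i s
  V_le : ∀ i, ∃ γ : ℝ, 0 < γ ∧ ∀ s ∈ J i, (V i s : ℝ) ≤ 1 - γ
  -- Almost-sure termination.
  W_pos : ∀ i, ∀ s ∈ I \ (B i ∪ J i), 0 < W i s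
  W_eq_zero : ∀ i, ∀ s ∈ I ∩ (B i ∪ J i), W i s = 0
  post_W_le : ∀ i, ∀ s ∈ I \ (B i ∪ J i), postExp P (W i) s ≤ W i s
  progress : ∀ i, ∀ r : ℝ≥0, 0 < r → ∀ s ∈ I \ (B i ∪ J i), W i s = r →
    ENNReal.ofReal (p i r) ≤ P s {s' | (W i s' : ℝ) ≤ (r : ℝ) - d i r}
  p_antitone : ∀ i, ∀ r₁ r₂ : ℝ≥0, 0 < r₁ → 0 < r₂ → r₁ ≤ r₂ → p i r₂ ≤ p i r₁
  d_antitone : ∀ i, ∀ r₁ r₂ : ℝ≥0, 0 < r₁ → 0 < r₂ → r₁ ≤ r₂ → d i r₂ ≤ d i r₁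
  -- Quantitative safety.
  post_V₀_le : ∀ s ∈ I, postExp P V₀ s ≤ V₀ s
  one_le_V₀ : ∀ s ∉ I, 1 ≤ V₀ s

end

/-! Let `E` be the Streett event and `c = 1 + ε`. Since `E` is shift-invariant, the failure
probability of `E` from `s` is harmonic. `V₀` is `c` times it, and `I` is where `V₀ < 1`, so on `I`
failure has probability at most `c⁻¹ < 1`. `V i` is the probability of ever hitting `A i`, and `J i`
is the part of `I` where it is at most `1/2`.

Termination is proved for the target `T i = Iᶜ ∪ B i ∪ J i`. Outside `T i` the set `A i` is hit with
probability at least `1/2`, so a path avoiding `T i` almost surely visits `A i` infinitely often and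
`B i` never, hence lies outside `E`. Avoiding `T i` thus has probability at most `c⁻¹` from every
state, and a zero-one law makes it null (`pathMeasure_avoid_eq_zero_of_streett`).

Almost-sure termination yields `W i` (`exists_ranking_certificate`): a strict supermartingale with
finite sublevel sets off the target, so that decrease rates can be chosen uniformly on each sublevel
set. -/

/-! ### Sequences and random maps -/

/-- Prepend a point to a sequence. -/
def consSeq {X : Type*} (x : X × (ℕ → X)) : ℕ → X
  | 0 => x.1
  | n + 1 => x.2 n

lemma measurable_consSeq {X : Type*} [MeasurableSpace X] :
    Measurable (consSeq : X × (ℕ → X) → ℕ → X) := by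
  refine measurable_pi_iff.2 fun n => ?_
  cases n with
  | zero => exact measurable_fst
  | succ n => exact (measurable_pi_apply n).comp measurable_snd

/-- Splits off the first of the i.i.d. random maps; the Markov property at time one rests on this.
-/
lemma map_consSeq_infinitePi {X : Type*} [MeasurableSpace X] (ν : Measure X)
    [IsProbabilityMeasure ν] :
    (ν.prod (Measure.infinitePi fun _ : ℕ => ν)).map consSeq =
      Measure.infinitePi fun _ : ℕ => ν := by
  classical
  refine Measure.eq_infinitePi _ fun s t ht => ?_
  obtain ⟨N, hN⟩ : ∃ N, s ⊆ Finset.range (N + 1) :=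
    ⟨s.sup id, fun i hi => Finset.mem_range_succ_iff.2 (Finset.le_sup (f := id) hi)⟩
  set t' : ℕ → Set X := fun i => if i ∈ s then t i else Set.univ with ht'
  have hmt' : ∀ i, MeasurableSet (t' i) := fun i => by
    simp only [ht']; split_ifs
    exacts [ht i, MeasurableSet.univ]
  have hprod : ∏ i ∈ s, ν (t i) = ∏ i ∈ Finset.range (N + 1), ν (t' i) := by
    rw [← Finset.prod_subset hN (f := fun i => ν (t' i))]
    · exact Finset.prod_congr rfl fun i hi => by simp [ht', hi]
    · intro i _ hi
      simp [ht', hi]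
  have hpre : consSeq ⁻¹' (Set.pi s t) =
      t' 0 ×ˢ Set.pi (Finset.range N) (fun i => t' (i + 1)) := by
    ext ⟨x, F⟩
    simp only [Set.mem_preimage, Set.mem_pi, Finset.mem_coe, Set.mem_prod, Finset.mem_range, ht']
    constructor
    · intro h
      refine ⟨?_, fun i _ => ?_⟩
      · split_ifs with h0
        exacts [h 0 h0, trivial]
      · split_ifs with h0
        exacts [h (i + 1) h0, trivial]
    · rintro ⟨h0, h⟩ i hi
      cases i with
      | zero => simpa [hi, consSeq] using h0
      | succ i =>
        have := h i (by have := Finset.mem_range.1 (hN hi); omega)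
        simpa [hi, consSeq] using this
  rw [Measure.map_apply measurable_consSeq (.pi s.countable_toSet fun i _ => ht i), hpre,
    Measure.prod_prod, Measure.infinitePi_pi _ (fun i _ => hmt' _), hprod,
    Finset.prod_range_succ', mul_comm]

/-- The trajectory from `s` under a sequence of maps. -/
def mapPath {S : Type*} : (ℕ → S → S) → S → ℕ → S
  | _, s, 0 => s
  | F, s, n + 1 => mapPath (fun i => F (i + 1)) (F 0 s) n

/-! ### Path measures, the Markov property, and the law of the chain -/

section PathMeasure

set_option linter.unusedSectionVars false

variable {S : Type*} [Countable S] [MeasurableSpace S] [DiscreteMeasurableSpace S]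

lemma measurable_mapPath : Measurable fun x : (ℕ → S → S) × S => mapPath x.1 x.2 := by
  refine measurable_pi_iff.2 fun n => ?_
  induction n with
  | zero => exact measurable_snd
  | succ n ih =>
    have h : Measurable fun x : (ℕ → S → S) × S => ((fun i => x.1 (i + 1)), x.1 0 x.2) := by
      refine Measurable.prodMk (by fun_prop) ?_
      refine measurable_from_prod_countable_left fun s => ?_
      exact (measurable_pi_apply s).comp (measurable_pi_apply 0)
    exact ih.comp h

variable (P : Kernel S S) [IsMarkovKernel P]

/-- The law of a sequence of independent random maps, each moving `s` according to `P s`. -/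
noncomputable def randomMaps : Measure (ℕ → S → S) :=
  Measure.infinitePi fun _ => Measure.infinitePi fun s => P s

instance : IsProbabilityMeasure (randomMaps P) := by
  unfold randomMaps; infer_instance

/-- The law of the Markov chain started in `s`. -/
noncomputable def pathMeasure : Kernel S (ℕ → S) where
  toFun s := (randomMaps P).map fun F => mapPath F s
  measurable' := Measurable.of_discrete

lemma measurable_mapPath_left (s : S) : Measurable fun F : ℕ → S → S => mapPath F s :=
  measurable_mapPath.comp (by fun_prop : Measurable fun F : ℕ → S → S => (F, s))

lemma pathMeasure_apply (s : S) {D : Set (ℕ → S)} (hD : MeasurableSet D) :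
    pathMeasure P s D = randomMaps P {F | mapPath F s ∈ D} :=
  Measure.map_apply (measurable_mapPath_left s) hD

instance : IsMarkovKernel (pathMeasure P) :=
  ⟨fun s => Measure.isProbabilityMeasure_map (measurable_mapPath_left s).aemeasurable⟩

lemma pathMeasure_start (s : S) : ∀ᵐ ω ∂(pathMeasure P s), ω 0 = s := by
  refine (ae_map_iff (measurable_mapPath_left s).aemeasurable ?_).2 (ae_of_all _ fun F => rfl)
  exact measurableSet_eq_fun (measurable_pi_apply 0) measurable_const

/-- The shift of a trajectory. -/
def shiftSeq {X : Type*} (ω : ℕ → X) : ℕ → X := fun n => ω (n + 1)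

lemma measurable_shiftSeq {X : Type*} [MeasurableSpace X] :
    Measurable (shiftSeq : (ℕ → X) → ℕ → X) := by unfold shiftSeq; fun_prop

/-- The Markov property: the first map evaluated at `s` has law `P s` and is independent of the
later maps, which again have law `randomMaps P`. -/
lemma pathMeasure_shift (s : S) {D : Set (ℕ → S)} (hD : MeasurableSet D) :
    pathMeasure P s (shiftSeq ⁻¹' D) = ∫⁻ t, pathMeasure P t D ∂(P s) := by
  have hjoint : MeasurableSet {x : S × (ℕ → S → S) | mapPath x.2 x.1 ∈ D} :=
    (measurable_mapPath.comp measurable_swap) hD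
  have hmap : MeasurePreserving
      (Prod.map (fun f : S → S => f s) (id : (ℕ → S → S) → (ℕ → S → S)))
      ((Measure.infinitePi fun s => P s).prod (randomMaps P)) ((P s).prod (randomMaps P)) :=
    (measurePreserving_eval_infinitePi (fun s => P s) s).prod (MeasurePreserving.id _)
  rw [pathMeasure_apply P s (measurable_shiftSeq hD)]
  conv_lhs => rw [randomMaps, ← map_consSeq_infinitePi]
  rw [Measure.map_apply measurable_consSeq (show MeasurableSet {F | mapPath F s ∈ shiftSeq ⁻¹' D}
    from (measurable_mapPath_left s) (measurable_shiftSeq hD))]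
  change ((Measure.infinitePi fun s => P s).prod (randomMaps P)) (Prod.map (fun f : S → S => f s)
    (id : (ℕ → S → S) → (ℕ → S → S)) ⁻¹' {x : S × (ℕ → S → S) | mapPath x.2 x.1 ∈ D}) = _
  rw [hmap.measure_preimage hjoint.nullMeasurableSet, Measure.prod_apply hjoint]
  exact lintegral_congr fun t => (pathMeasure_apply P t hD).symm

lemma pathMeasure_mono_start (s : S) {D D' : Set (ℕ → S)}
    (h : ∀ ω ∈ D, ω 0 = s → ω ∈ D') : pathMeasure P s D ≤ pathMeasure P s D' :=
  measure_mono_ae <| by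
    filter_upwards [pathMeasure_start P s] with ω hω hD using h ω hD hω

lemma lintegral_pathMeasure_le (s : S) {D D' : Set (ℕ → S)} (hD : MeasurableSet D)
    (h : ∀ ω, ω 0 = s → shiftSeq ω ∈ D → ω ∈ D') :
    ∫⁻ t, pathMeasure P t D ∂(P s) ≤ pathMeasure P s D' := by
  rw [← pathMeasure_shift P s hD]
  exact pathMeasure_mono_start P s fun ω hω h0 => h ω h0 hω

lemma le_lintegral_pathMeasure (s : S) {D D' : Set (ℕ → S)} (hD : MeasurableSet D)
    (h : ∀ ω, ω 0 = s → ω ∈ D' → shiftSeq ω ∈ D) :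
    pathMeasure P s D' ≤ ∫⁻ t, pathMeasure P t D ∂(P s) := by
  rw [← pathMeasure_shift P s hD]
  exact pathMeasure_mono_start P s fun ω hω h0 => h ω h0 hω

lemma pathMeasure_eq_zero_of_start (s : S) {D : Set (ℕ → S)} (h : ∀ ω ∈ D, ω 0 ≠ s) :
    pathMeasure P s D = 0 := by
  simpa using pathMeasure_mono_start P s (D := D) (D' := ∅) fun ω hω h0 => h ω hω h0

lemma pathMeasure_eq_one_of_start (s : S) {D : Set (ℕ → S)} (h : ∀ ω, ω 0 = s → ω ∈ D) :
    pathMeasure P s D = 1 :=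
  le_antisymm prob_le_one <| by
    simpa using pathMeasure_mono_start P s (D := Set.univ) (D' := D) fun ω _ h0 => h ω h0

lemma pathMeasure_box (n : ℕ) : ∀ (A : ℕ → Set S) (s : S),
    pathMeasure P s {ω | ∀ i ≤ n, ω i ∈ A i} =
      (A 0).indicator (iterKernelProb P n fun i => A (i + 1)) s := by
  have key : ∀ (m : ℕ) (A : ℕ → Set S) (s : S), s ∉ A 0 →
      pathMeasure P s {ω | ∀ i ≤ m, ω i ∈ A i} = 0 := fun m A s hs =>
    pathMeasure_eq_zero_of_start P s fun ω hω h0 => hs (h0 ▸ hω 0 (Nat.zero_le _))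
  induction n with
  | zero =>
    intro A s
    by_cases hs : s ∈ A 0
    · rw [Set.indicator_of_mem hs]
      exact pathMeasure_eq_one_of_start P s fun ω h0 i hi => by
        obtain rfl := Nat.le_zero.1 hi
        rwa [h0]
    · rw [Set.indicator_of_notMem hs, key _ A s hs]
  | succ n ih =>
    intro A s
    by_cases hs : s ∈ A 0
    · have hm : MeasurableSet {ω : ℕ → S | ∀ i ≤ n, ω i ∈ A (i + 1)} := by
        simp only [Set.ofPred_forall]
        exact .iInter fun i => .iInter fun _ => measurable_pi_apply i (.of_discrete)
      have e : pathMeasure P s {ω | ∀ i ≤ n + 1, ω i ∈ A i} =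
          ∫⁻ t, pathMeasure P t {ω | ∀ i ≤ n, ω i ∈ A (i + 1)} ∂(P s) := by
        refine le_antisymm (le_lintegral_pathMeasure P s hm fun ω _ h i hi => h _ (by omega))
          (lintegral_pathMeasure_le P s hm fun ω h0 h i hi => ?_)
        cases i with
        | zero => rwa [h0]
        | succ i => exact h i (by omega)
      rw [Set.indicator_of_mem hs, e, iterKernelProb, ← lintegral_indicator (.of_discrete)]
      refine lintegral_congr fun t => ?_
      exact ih (fun i => A (i + 1)) t
    · rw [Set.indicator_of_notMem hs, key _ A s hs]

/-- The law of a Markov chain is the mixture of the path measures. -/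
lemma IsHomogeneousMarkovChain.law_eq {Ω : Type*} [MeasurableSpace Ω] {μ : Measure S}
    {Pr : Measure Ω} [IsProbabilityMeasure Pr] {Φ : ℕ → Ω → S}
    (hΦ : IsHomogeneousMarkovChain μ P Pr Φ) {D : Set (ℕ → S)} (hD : MeasurableSet D) :
    Pr {ω | (fun n => Φ n ω) ∈ D} = ∫⁻ s, pathMeasure P s D ∂μ := by
  classical
  have hm : Measurable fun ω n => Φ n ω := measurable_pi_iff.2 hΦ.measurable
  have : IsProbabilityMeasure (Pr.map fun ω n => Φ n ω) :=
    Measure.isProbabilityMeasure_map hm.aemeasurable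
  suffices h : Pr.map (fun ω n => Φ n ω) = μ.bind (pathMeasure P) by
    rw [← Measure.bind_apply hD (pathMeasure P).aemeasurable, ← h, Measure.map_apply hm hD]
    rfl
  refine ext_of_generate_finite _ (generateFrom_squareCylinders (α := fun _ : ℕ => S)).symm
    (isPiSystem_squareCylinders (fun _ => MeasurableSpace.isPiSystem_measurableSet)
      fun _ => .univ) ?_ ?_
  · rintro _ ⟨s, t, ht, rfl⟩
    obtain ⟨N, hN⟩ : ∃ N, s ⊆ Finset.range (N + 1) :=
      ⟨s.sup id, fun i hi => Finset.mem_range_succ_iff.2 (Finset.le_sup (f := id) hi)⟩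
    have e : Set.pi s t = {ω : ℕ → S | ∀ i ≤ N, ω i ∈ if i ∈ s then t i else Set.univ} := by
      ext ω
      simp only [Set.mem_pi, Finset.mem_coe, Set.mem_ofPred_eq]
      constructor
      · intro h i _
        split_ifs with hi
        exacts [h i hi, trivial]
      · intro h i hi
        simpa [hi] using h i (Finset.mem_range_succ_iff.1 (hN hi))
    have hbox : MeasurableSet (Set.pi s t) := .pi s.countable_toSet fun i _ => .of_discrete
    rw [Measure.bind_apply hbox (pathMeasure P).aemeasurable, Measure.map_apply hm hbox, e]
    simp_rw [pathMeasure_box]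
    rw [lintegral_indicator .of_discrete]
    exact hΦ.finite_dim N _ fun _ => .of_discrete
  -- The case `n = 0` with no constraint gives `μ` total mass one.
  · have h1 := hΦ.finite_dim 0 (fun _ => Set.univ) fun _ => .univ
    rw [Measure.bind_apply .univ (pathMeasure P).aemeasurable, measure_univ]
    simp [iterKernelProb] at h1
    simp [← h1]

end PathMeasure

/-! ### Avoidance probabilities and a zero-one law -/

section Avoidance

set_option linter.unusedSectionVars false

open Filter Topology

variable {S : Type*} [Countable S] [MeasurableSpace S] [DiscreteMeasurableSpace S]
variable (P : Kernel S S) [IsMarkovKernel P]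

/-- The trajectories that never visit `T`. -/
def avoid (T : Set S) : Set (ℕ → S) := {ω | ∀ n, ω n ∉ T}

/-- The trajectories that do not visit `T` up to time `N`. -/
def avoidUpTo (T : Set S) (N : ℕ) : Set (ℕ → S) := {ω | ∀ i ≤ N, ω i ∉ T}

/-- The trajectories that visit `T`. -/
def hits (T : Set S) : Set (ℕ → S) := {ω | ∃ n, ω n ∈ T}

lemma measurableSet_eval (n : ℕ) (T : Set S) : MeasurableSet {ω : ℕ → S | ω n ∈ T} :=
  measurable_pi_apply n (.of_discrete)

lemma measurableSet_avoid (T : Set S) : MeasurableSet (avoid T) := by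
  simp only [avoid, Set.ofPred_forall]
  exact .iInter fun n => measurableSet_eval n Tᶜ

lemma measurableSet_avoidUpTo (T : Set S) (N : ℕ) : MeasurableSet (avoidUpTo T N) := by
  simp only [avoidUpTo, Set.ofPred_forall]
  exact .iInter fun n => .iInter fun _ => measurableSet_eval n Tᶜ

lemma measurableSet_hits (T : Set S) : MeasurableSet (hits T) := by
  simp only [hits, Set.ofPred_exists]
  exact .iUnion fun n => measurableSet_eval n T

lemma antitone_avoidUpTo (T : Set S) : Antitone (avoidUpTo T) :=
  fun _ _ h _ hω i hi => hω i (hi.trans h)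

lemma pathMeasure_avoid_of_mem {T : Set S} {s : S} (hs : s ∈ T) :
    pathMeasure P s (avoid T) = 0 :=
  pathMeasure_eq_zero_of_start P s fun _ hω h0 => hω 0 (h0 ▸ hs)

lemma pathMeasure_avoidUpTo_of_mem {T : Set S} {s : S} (hs : s ∈ T) (N : ℕ) :
    pathMeasure P s (avoidUpTo T N) = 0 :=
  pathMeasure_eq_zero_of_start P s fun _ hω h0 => hω 0 (Nat.zero_le _) (h0 ▸ hs)

lemma pathMeasure_avoidUpTo_zero {T : Set S} {s : S} (hs : s ∉ T) :
    pathMeasure P s (avoidUpTo T 0) = 1 :=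
  pathMeasure_eq_one_of_start P s fun ω h0 i hi => by
    obtain rfl := Nat.le_zero.1 hi
    rwa [h0]

lemma lintegral_avoidUpTo_le {T : Set S} {s : S} (hs : s ∉ T) (N : ℕ) :
    ∫⁻ t, pathMeasure P t (avoidUpTo T N) ∂(P s) ≤ pathMeasure P s (avoidUpTo T (N + 1)) :=
  lintegral_pathMeasure_le P s (measurableSet_avoidUpTo T N) fun ω h0 h i hi => by
    cases i with
    | zero => rwa [h0]
    | succ i => exact h i (by omega)

lemma tendsto_pathMeasure_avoidUpTo (T : Set S) (s : S) :
    Tendsto (fun N => pathMeasure P s (avoidUpTo T N)) atTop (𝓝 (pathMeasure P s (avoid T))) := by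
  have e : avoid T = ⋂ N, avoidUpTo T N := by
    ext ω
    simp only [avoid, avoidUpTo, Set.mem_ofPred_eq, Set.mem_iInter]
    exact ⟨fun h _ i _ => h i, fun h n => h n n le_rfl⟩
  rw [e]
  exact tendsto_measure_iInter_atTop
    (fun N => (measurableSet_avoidUpTo T N).nullMeasurableSet) (antitone_avoidUpTo T)
    ⟨0, measure_ne_top _ _⟩

/-- To avoid `T` forever, a path must avoid it up to time `N` and then, from its current state,
forever; the latter costs a factor `c`. -/
lemma pathMeasure_avoid_le_mul {T : Set S} {c : ℝ≥0∞}
    (h : ∀ s, pathMeasure P s (avoid T) ≤ c) (N : ℕ) :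
    ∀ s, pathMeasure P s (avoid T) ≤ c * pathMeasure P s (avoidUpTo T N) := by
  induction N with
  | zero =>
    intro s
    by_cases hs : s ∈ T
    · simp [pathMeasure_avoid_of_mem P hs]
    · simpa [pathMeasure_avoidUpTo_zero P hs] using h s
  | succ N ih =>
    intro s
    by_cases hs : s ∈ T
    · simp [pathMeasure_avoid_of_mem P hs]
    · calc pathMeasure P s (avoid T) ≤ ∫⁻ t, pathMeasure P t (avoid T) ∂(P s) :=
            le_lintegral_pathMeasure P s (measurableSet_avoid T) fun ω _ h n => h (n + 1)
        _ ≤ ∫⁻ t, c * pathMeasure P t (avoidUpTo T N) ∂(P s) := lintegral_mono ih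
        _ = c * ∫⁻ t, pathMeasure P t (avoidUpTo T N) ∂(P s) :=
            lintegral_const_mul _ Measurable.of_discrete
        _ ≤ _ := by gcongr; exact lintegral_avoidUpTo_le P hs N

/-- A zero-one law: avoidance probabilities bounded away from `1` vanish. -/
lemma pathMeasure_avoid_eq_zero {T : Set S} {c : ℝ≥0∞} (hc : c < 1)
    (h : ∀ s, pathMeasure P s (avoid T) ≤ c) (s : S) : pathMeasure P s (avoid T) = 0 := by
  have hlim : pathMeasure P s (avoid T) ≤ c * pathMeasure P s (avoid T) :=
    -- As `N → ∞` the avoidance probability `x` satisfies `x ≤ c * x`, with `x` finite and `c < 1`.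
    ge_of_tendsto' (ENNReal.Tendsto.const_mul (tendsto_pathMeasure_avoidUpTo P T s)
      (Or.inr hc.ne_top)) fun N => pathMeasure_avoid_le_mul P h N s
  by_contra h0
  refine absurd hlim (not_le.2 ?_)
  simpa using ENNReal.mul_lt_mul_left h0 (measure_ne_top _ _) hc

lemma pathMeasure_tail_eq_zero {D : Set (ℕ → S)} (hD : MeasurableSet D)
    (h : ∀ s, pathMeasure P s D = 0) (n : ℕ) :
    ∀ s, pathMeasure P s {ω | (fun m => ω (m + n)) ∈ D} = 0 := by
  induction n with
  | zero => exact h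
  | succ n ih =>
    intro s
    have hm : MeasurableSet {ω : ℕ → S | (fun m => ω (m + n)) ∈ D} :=
      (by fun_prop : Measurable fun (ω : ℕ → S) m => ω (m + n)) hD
    have := pathMeasure_shift P s hm
    simp only [ih, lintegral_zero] at this
    exact this

/-- If from every state outside `T ⊇ B` the set `A` is visited with probability at least `1/2`
and the Streett condition fails with probability at most `θ < 1`, then `T` is visited almost
surely. -/
lemma pathMeasure_avoid_eq_zero_of_streett {A B T : Set S} {E : Set (ℕ → S)} {θ : ℝ≥0∞}
    (hθ : θ < 1) (hBT : B ⊆ T) (hE : ∀ s ∉ T, pathMeasure P s Eᶜ ≤ θ)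
    (hEAB : E ⊆ finVisits (fun n (ω : ℕ → S) => ω n) A ∪ infVisits (fun n ω => ω n) B)
    (hA : ∀ s ∉ T, 2⁻¹ ≤ pathMeasure P s (hits A)) (s : S) :
    pathMeasure P s (avoid T) = 0 := by
  have hTA : ∀ s, pathMeasure P s (avoid (T ∪ A)) = 0 := by
    refine pathMeasure_avoid_eq_zero P ENNReal.one_half_lt_one fun s => ?_
    by_cases hs : s ∈ T
    · rw [pathMeasure_avoid_of_mem P (Set.mem_union_left A hs)]
      exact zero_le
    · calc pathMeasure P s (avoid (T ∪ A)) ≤ pathMeasure P s (hits A)ᶜ :=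
            measure_mono fun ω hω ⟨n, hn⟩ => hω n (Or.inr hn)
        _ = 1 - pathMeasure P s (hits A) := prob_compl_eq_one_sub (measurableSet_hits A)
        _ ≤ 1 - 2⁻¹ := tsub_le_tsub_left (hA s hs) _
        _ = 2⁻¹ := ENNReal.one_sub_inv_two
  refine pathMeasure_avoid_eq_zero P hθ (fun s => ?_) s
  by_cases hs : s ∈ T
  · simp [pathMeasure_avoid_of_mem P hs]
  -- A path in `E` avoiding `T ⊇ B` never sees `B`, so it visits `A` finitely often and eventually
  -- avoids `T ∪ A`, a null event by `hTA`.
  have hsub : avoid T ⊆ Eᶜ ∪ ⋃ n, {ω | (fun m => ω (m + n)) ∈ avoid (T ∪ A)} := by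
    intro ω hω
    by_cases hωE : ω ∈ E
    · right
      rcases hEAB hωE with h | h
      · obtain ⟨n, hn⟩ := Set.mem_iUnion.1 h
        refine Set.mem_iUnion.2 ⟨n, fun m hm => ?_⟩
        rcases hm with hm | hm
        · exact hω _ hm
        · exact Set.mem_iInter₂.1 hn (m + n) (Nat.le_add_left _ _) hm
      · obtain ⟨m, _, hm⟩ := Set.mem_iUnion₂.1 (Set.mem_iInter.1 h 0)
        exact absurd (hBT hm) (hω m)
    · exact Or.inl hωE
  calc pathMeasure P s (avoid T) ≤ _ := measure_mono hsub
    _ ≤ pathMeasure P s Eᶜ + pathMeasure P s (⋃ n, {ω | (fun m => ω (m + n)) ∈ avoid (T ∪ A)}) :=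
        measure_union_le _ _
    _ = pathMeasure P s Eᶜ := by
        rw [measure_iUnion_null fun n =>
          pathMeasure_tail_eq_zero P (measurableSet_avoid _) hTA n s, add_zero]
    _ ≤ θ := hE s hs

end Avoidance

/-! ### Ranking supermartingales for almost-sure termination -/

section Termination

set_option linter.unusedSectionVars false

open Filter Topology

variable {S : Type*} [Countable S] [MeasurableSpace S] [DiscreteMeasurableSpace S]
variable (P : Kernel S S) [IsMarkovKernel P]

/-- The trajectories that reach a state of rank at least `n` before visiting `T`. -/
def escapes (T : Set S) (f : S → ℕ) (n : ℕ) : Set (ℕ → S) :=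
  {ω | ∃ m, n ≤ f (ω m) ∧ ∀ j ≤ m, ω j ∉ T}

lemma measurableSet_escapes (T : Set S) (f : S → ℕ) (n : ℕ) : MeasurableSet (escapes T f n) := by
  have e : escapes T f n = ⋃ m, {ω | ω m ∈ {s | n ≤ f s}} ∩ avoidUpTo T m := by
    ext ω
    simp [escapes, avoidUpTo]
  rw [e]
  exact .iUnion fun m => (measurableSet_eval m _).inter (measurableSet_avoidUpTo T m)

lemma antitone_escapes (T : Set S) (f : S → ℕ) : Antitone (escapes T f) :=
  fun _ _ h _ ⟨m, hm, hT⟩ => ⟨m, h.trans hm, hT⟩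

/-- A path entering `T` at time `N` meets only finitely many states beforehand, so its ranks before
then are bounded. -/
lemma iInter_escapes_subset (T : Set S) (f : S → ℕ) : ⋂ n, escapes T f n ⊆ avoid T := by
  intro ω hω N hN
  obtain ⟨m, hm, hT⟩ :=
    Set.mem_iInter.1 hω ((Finset.range N).sup (fun i => f (ω i)) + 1)
  have hmN : m < N := lt_of_not_ge fun h => hT N h hN
  have := Finset.le_sup (f := fun i => f (ω i)) (Finset.mem_range.2 hmN)
  omega

lemma pathMeasure_escapes_of_mem {T : Set S} (f : S → ℕ) {s : S} (hs : s ∈ T) (n : ℕ) :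
    pathMeasure P s (escapes T f n) = 0 :=
  pathMeasure_eq_zero_of_start P s fun _ ⟨_, _, hT⟩ h0 => hT 0 (Nat.zero_le _) (h0 ▸ hs)

lemma pathMeasure_escapes_eq_one {T : Set S} {f : S → ℕ} {s : S} (hs : s ∉ T) {n : ℕ}
    (hn : n ≤ f s) : pathMeasure P s (escapes T f n) = 1 :=
  pathMeasure_eq_one_of_start P s fun ω h0 => ⟨0, by rwa [h0], fun j hj => by
    obtain rfl := Nat.le_zero.1 hj
    rwa [h0]⟩

lemma lintegral_escapes_le {T : Set S} (f : S → ℕ) {s : S} (hs : s ∉ T) (n : ℕ) :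
    ∫⁻ t, pathMeasure P t (escapes T f n) ∂(P s) ≤ pathMeasure P s (escapes T f n) :=
  lintegral_pathMeasure_le P s (measurableSet_escapes T f n) fun ω h0 ⟨m, hm, hT⟩ =>
    ⟨m + 1, hm, fun j hj => by
      cases j with
      | zero => rwa [h0]
      | succ j => exact hT j (by omega)⟩

lemma tendsto_pathMeasure_escapes {T : Set S} (hT : ∀ s, pathMeasure P s (avoid T) = 0)
    (f : S → ℕ) (s : S) : Tendsto (fun n => pathMeasure P s (escapes T f n)) atTop (𝓝 0) := by
  rw [← measure_mono_null (iInter_escapes_subset T f) (hT s)]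
  exact tendsto_measure_iInter_atTop
    (fun n => (measurableSet_escapes T f n).nullMeasurableSet) (antitone_escapes T f)
    ⟨0, measure_ne_top _ _⟩

lemma tendsto_lintegral_escapes {T : Set S} (hT : ∀ s, pathMeasure P s (avoid T) = 0)
    (f : S → ℕ) (s : S) :
    Tendsto (fun n => ∫⁻ t, pathMeasure P t (escapes T f n) ∂(P s)) atTop (𝓝 0) := by
  have := tendsto_lintegral_of_dominated_convergence (μ := P s)
    (F := fun n t => pathMeasure P t (escapes T f n)) (f := fun _ => 0) (fun _ => 1)
    (fun _ => Measurable.of_discrete) (fun n => ae_of_all _ fun t => prob_le_one) (by simp)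
    (ae_of_all _ fun t => tendsto_pathMeasure_escapes P hT f t)
  simpa using this

lemma tsum_ne_top_of_le_two {a : ℕ → ℝ≥0∞} (N : ℕ) (h2 : ∀ k, a k ≤ 2)
    (h : ∀ k, N ≤ k → a k ≤ 2 * 2⁻¹ ^ k) : ∑' k, a k ≠ ∞ := by
  have hle : ∀ k, a k ≤ 2 * 2 ^ N * 2⁻¹ ^ k := by
    intro k
    rcases le_or_gt N k with hk | hk
    · refine (h k hk).trans ?_
      gcongr
      exact le_mul_of_one_le_right' (one_le_pow_of_one_le' (by norm_num) N)
    · refine (h2 k).trans ?_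
      rw [mul_assoc]
      refine le_mul_of_one_le_right' ?_
      calc (1 : ℝ≥0∞) = 2 ^ k * 2⁻¹ ^ k := by
            rw [← mul_pow, ENNReal.mul_inv_cancel (by norm_num) (by norm_num), one_pow]
        _ ≤ 2 ^ N * 2⁻¹ ^ k := by
            gcongr
            norm_num
  refine ne_top_of_le_ne_top ?_ (ENNReal.tsum_le_tsum hle)
  rw [ENNReal.tsum_mul_left, ENNReal.tsum_geometric, ENNReal.one_sub_inv_two, inv_inv]
  exact ENNReal.mul_ne_top (ENNReal.mul_ne_top (by norm_num) (by simp)) (by norm_num)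

/-- Injectivity leaves finitely many states of rank at most `k`, so one `n k` serves them all. The
bounds make `ranking` and its post-expectation finite. -/
lemma exists_seq_escapes_small {T : Set S} (hT : ∀ s, pathMeasure P s (avoid T) = 0)
    {f : S → ℕ} (hf : f.Injective) :
    ∃ n : ℕ → ℕ, ∀ k s, f s ≤ k → pathMeasure P s (escapes T f (n k)) ≤ 2⁻¹ ^ k ∧
      ∫⁻ t, pathMeasure P t (escapes T f (n k)) ∂(P s) ≤ 2⁻¹ ^ k := by
  have : ∀ k, ∃ n, ∀ s ∈ {s | f s ≤ k}, pathMeasure P s (escapes T f n) ≤ 2⁻¹ ^ k ∧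
      ∫⁻ t, pathMeasure P t (escapes T f n) ∂(P s) ≤ 2⁻¹ ^ k := by
    intro k
    have hfin : {s | f s ≤ k}.Finite := (Set.finite_Iic k).preimage hf.injOn
    have hpos : (0 : ℝ≥0∞) < 2⁻¹ ^ k := ENNReal.pow_pos (by simp) k
    exact ((eventually_all_finite hfin).2 fun s _ =>
      ((tendsto_pathMeasure_escapes P hT f s).eventually (Iic_mem_nhds hpos)).and
        ((tendsto_lintegral_escapes P hT f s).eventually (Iic_mem_nhds hpos))).exists
  choose n hn using this
  exact ⟨n, hn⟩

/-- The sum of a bounded strict supermartingale and a proper supermartingale, both stopped on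
visiting `T`. -/
noncomputable def ranking (T : Set S) (f : S → ℕ) (n : ℕ → ℕ) (s : S) : ℝ≥0∞ :=
  ∑' k, (2⁻¹ ^ k * pathMeasure P s (avoidUpTo T k) + pathMeasure P s (escapes T f (n k)))

lemma lintegral_ranking (T : Set S) (f : S → ℕ) (n : ℕ → ℕ) (s : S) :
    ∫⁻ t, ranking P T f n t ∂(P s) =
      ∑' k, (2⁻¹ ^ k * ∫⁻ t, pathMeasure P t (avoidUpTo T k) ∂(P s) +
        ∫⁻ t, pathMeasure P t (escapes T f (n k)) ∂(P s)) := by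
  unfold ranking
  rw [lintegral_tsum fun k => Measurable.of_discrete.aemeasurable]
  refine tsum_congr fun k => ?_
  rw [lintegral_add_left Measurable.of_discrete, lintegral_const_mul _ Measurable.of_discrete]

lemma inv_two_pow_le_one (k : ℕ) : (2⁻¹ : ℝ≥0∞) ^ k ≤ 1 :=
  pow_le_one' (ENNReal.inv_le_one.2 (by norm_num)) k

lemma lintegral_pathMeasure_le_one (s : S) (D : Set (ℕ → S)) :
    ∫⁻ t, pathMeasure P t D ∂(P s) ≤ 1 :=
  (lintegral_mono fun _ => prob_le_one).trans (by simp)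

lemma ranking_ne_top {T : Set S} {f : S → ℕ} {n : ℕ → ℕ} {s : S}
    (h : ∀ k, f s ≤ k → pathMeasure P s (escapes T f (n k)) ≤ 2⁻¹ ^ k) :
    ranking P T f n s ≠ ∞ := by
  refine tsum_ne_top_of_le_two (f s) (fun k => ?_) fun k hk => ?_
  · exact (add_le_add (mul_le_mul' (inv_two_pow_le_one k) prob_le_one) prob_le_one).trans
      (by norm_num)
  · rw [two_mul]
    exact add_le_add (mul_le_of_le_one_right' prob_le_one) (h k hk)

lemma lintegral_ranking_ne_top {T : Set S} {f : S → ℕ} {n : ℕ → ℕ} {s : S}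
    (h : ∀ k, f s ≤ k → ∫⁻ t, pathMeasure P t (escapes T f (n k)) ∂(P s) ≤ 2⁻¹ ^ k) :
    ∫⁻ t, ranking P T f n t ∂(P s) ≠ ∞ := by
  rw [lintegral_ranking]
  refine tsum_ne_top_of_le_two (f s) (fun k => ?_) fun k hk => ?_
  · exact (add_le_add (mul_le_mul' (inv_two_pow_le_one k) (lintegral_pathMeasure_le_one P s _))
      (lintegral_pathMeasure_le_one P s _)).trans (by norm_num)
  · rw [two_mul]
    exact add_le_add (mul_le_of_le_one_right' (lintegral_pathMeasure_le_one P s _)) (h k hk)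

lemma ranking_of_mem {T : Set S} (f : S → ℕ) (n : ℕ → ℕ) {s : S} (hs : s ∈ T) :
    ranking P T f n s = 0 := by
  simp [ranking, pathMeasure_avoidUpTo_of_mem P hs, pathMeasure_escapes_of_mem P f hs]

/-- No term of the sum increases in expectation. From `s ∉ T` the probabilities of avoiding `T` up
to time `k` start at `1` and tend to `0`, so they drop strictly at some `k`, and that term makes the
inequality strict. -/
lemma lintegral_ranking_lt {T : Set S} (hT : ∀ s, pathMeasure P s (avoid T) = 0)
    {f : S → ℕ} {n : ℕ → ℕ} {s : S} (hs : s ∉ T)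
    (hfin : ∫⁻ t, ranking P T f n t ∂(P s) ≠ ∞) :
    ∫⁻ t, ranking P T f n t ∂(P s) < ranking P T f n s := by
  obtain ⟨k, hk⟩ : ∃ k, pathMeasure P s (avoidUpTo T (k + 1)) <
      pathMeasure P s (avoidUpTo T k) := by
    by_contra! h
    have h1 : ∀ k, 1 ≤ pathMeasure P s (avoidUpTo T k) := by
      intro k
      induction k with
      | zero => exact (pathMeasure_avoidUpTo_zero P hs).ge
      | succ k ih => exact ih.trans (h k)
    have := ge_of_tendsto' (tendsto_pathMeasure_avoidUpTo P T s) h1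
    rw [hT] at this
    exact absurd this (by norm_num)
  have hU : ∀ k, ∫⁻ t, pathMeasure P t (avoidUpTo T k) ∂(P s) ≤
      pathMeasure P s (avoidUpTo T k) := fun k =>
    (lintegral_avoidUpTo_le P hs k).trans (measure_mono (antitone_avoidUpTo T k.le_succ))
  rw [lintegral_ranking] at hfin ⊢
  refine ENNReal.tsum_lt_tsum (i := k) hfin
    (fun j => add_le_add (mul_le_mul_right (hU j) _) (lintegral_escapes_le P f hs _)) ?_
  refine ENNReal.add_lt_add_of_lt_of_le
    ((lintegral_pathMeasure_le_one P s _).trans_lt ENNReal.one_lt_top).ne ?_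
    (lintegral_escapes_le P f hs _)
  exact ENNReal.mul_lt_mul_right (ENNReal.pow_pos (by simp) k).ne'
    ((inv_two_pow_le_one k).trans_lt ENNReal.one_lt_top).ne
    ((lintegral_avoidUpTo_le P hs k).trans_lt hk)

/-- A state outside `T` of large rank has already escaped past the first `K > r` thresholds, and
each contributes `1` to the sum. -/
lemma finite_ranking_le {T : Set S} {f : S → ℕ} (hf : f.Injective) (n : ℕ → ℕ) (r : ℝ≥0) :
    {s | s ∉ T ∧ ranking P T f n s ≤ r}.Finite := by
  obtain ⟨K, hK⟩ := exists_nat_gt r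
  refine ((Set.finite_Iio ((Finset.range K).sup n)).preimage hf.injOn).subset ?_
  rintro s ⟨hs, hr⟩
  by_contra hlt
  have hle : (Finset.range K).sup n ≤ f s := not_lt.1 hlt
  refine absurd hr (not_le.2 ?_)
  calc (r : ℝ≥0∞) < (K : ℝ≥0∞) := by exact_mod_cast hK
    _ = ∑ k ∈ Finset.range K, pathMeasure P s (escapes T f (n k)) := by
      rw [Finset.sum_congr rfl fun k hk =>
        pathMeasure_escapes_eq_one P hs ((Finset.le_sup (f := n) hk).trans hle)]
      simp
    _ ≤ ∑' k, pathMeasure P s (escapes T f (n k)) := ENNReal.sum_le_tsum _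
    _ ≤ ranking P T f n s := ENNReal.tsum_le_tsum fun k => le_add_self

/-- A strict supermartingale decreases by a fixed amount with positive probability. -/
lemma exists_decrease_of_lintegral_lt {W : S → ℝ≥0} {s : S}
    (h : ∫⁻ t, (W t : ℝ≥0∞) ∂(P s) < W s) :
    ∃ m : ℝ≥0, 0 < m ∧ m ≤ 1 ∧ (m : ℝ≥0∞) ≤ P s {t | W t + m ≤ W s} := by
  have hpos : P s {t | W t < W s} ≠ 0 := by
    intro h0
    refine absurd h (not_lt.2 ?_)
    have hae : ∀ᵐ t ∂(P s), (W s : ℝ≥0∞) ≤ W t := by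
      refine measure_mono_null (fun t ht => ?_) h0
      have : ¬ ((W s : ℝ≥0∞) ≤ W t) := ht
      exact_mod_cast not_le.1 this
    calc (W s : ℝ≥0∞) = ∫⁻ _, (W s : ℝ≥0∞) ∂(P s) := by simp
      _ ≤ _ := lintegral_mono_ae hae
  obtain ⟨j, hj⟩ : ∃ j : ℕ, P s {t | W t + 1 / ((j : ℝ≥0) + 1) ≤ W s} ≠ 0 := by
    by_contra! h0
    refine hpos (measure_mono_null (fun t ht => ?_) (measure_iUnion_null h0))
    have ht' : W t < W s := ht
    obtain ⟨j, hj⟩ := exists_nat_one_div_lt (tsub_pos_of_lt ht')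
    refine Set.mem_iUnion.2 ⟨j, ?_⟩
    have := add_le_add_right hj.le (W t)
    rwa [add_tsub_cancel_of_le ht'.le] at this
  -- One number serves as both the decrease and its probability, hence the minimum.
  refine ⟨min (1 / ((j : ℝ≥0) + 1)) (P s {t | W t + 1 / ((j : ℝ≥0) + 1) ≤ W s}).toNNReal,
    lt_min (by positivity) (ENNReal.toNNReal_pos hj (measure_ne_top _ _)), ?_, ?_⟩
  · refine (min_le_left _ _).trans ?_
    exact div_le_one_of_le₀ (by simp) zero_le
  · calc _ ≤ (((P s {t | W t + 1 / ((j : ℝ≥0) + 1) ≤ W s}).toNNReal : ℝ≥0) : ℝ≥0∞) :=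
          ENNReal.coe_le_coe.2 (min_le_right _ _)
      _ = P s {t | W t + 1 / ((j : ℝ≥0) + 1) ≤ W s} :=
          ENNReal.coe_toNNReal (measure_ne_top _ _)
      _ ≤ _ := measure_mono fun t (ht : W t + 1 / ((j : ℝ≥0) + 1) ≤ W s) =>
          (add_le_add_right (min_le_left _ _) (W t)).trans ht

/-- A uniform rate of decrease on sublevel sets, when these are finite. -/
lemma exists_uniform_rate {T : Set S} {W : S → ℝ≥0} (hfin : ∀ r, {s | s ∉ T ∧ W s ≤ r}.Finite)
    (h : ∀ s ∉ T, ∃ m : ℝ≥0, 0 < m ∧ m ≤ 1 ∧ (m : ℝ≥0∞) ≤ P s {t | W t + m ≤ W s}) :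
    ∃ δ : ℝ≥0 → ℝ≥0, Antitone δ ∧ (∀ r, 0 < δ r ∧ δ r ≤ 1) ∧
      ∀ s ∉ T, (δ (W s) : ℝ≥0∞) ≤ P s {t | W t + δ (W s) ≤ W s} := by
  have : ∀ s, ∃ m : ℝ≥0, 0 < m ∧ m ≤ 1 ∧
      (s ∉ T → (m : ℝ≥0∞) ≤ P s {t | W t + m ≤ W s}) := by
    intro s
    by_cases hs : s ∈ T
    · exact ⟨1, one_pos, le_rfl, fun h => absurd hs h⟩
    · obtain ⟨m, h0, h1, hm⟩ := h s hs
      exact ⟨m, h0, h1, fun _ => hm⟩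
  choose m hm0 hm1 hm using this
  -- With factors in `(0, 1]`, the product behaves like a minimum: it lies below each factor and
  -- shrinks as the sublevel set grows. It also equals `1` on the empty set.
  refine ⟨fun r => ∏ s ∈ (hfin r).toFinset, m s, fun r r' hr => ?_, fun r => ⟨?_, ?_⟩,
    fun s hs => ?_⟩
  · refine Finset.prod_le_prod_of_subset_of_le_one' (fun s hs => ?_) fun s _ _ => hm1 s
    simp only [Set.Finite.mem_toFinset, Set.mem_ofPred_eq] at hs ⊢
    exact ⟨hs.1, hs.2.trans hr⟩
  · exact Finset.prod_pos fun s _ => hm0 s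
  · exact Finset.prod_le_one' fun s _ => hm1 s
  · have hle : ∏ t ∈ (hfin (W s)).toFinset, m t ≤ m s := by
      rw [← Finset.prod_singleton m s]
      refine Finset.prod_le_prod_of_subset_of_le_one' (fun t ht => ?_) fun s _ _ => hm1 s
      obtain rfl := Finset.mem_singleton.1 ht
      simpa using hs
    exact (ENNReal.coe_le_coe.2 hle).trans ((hm s hs).trans
      (measure_mono fun t (ht : W t + m s ≤ W s) => (add_le_add_right hle (W t)).trans ht))

/-- Completeness of ranking supermartingales for almost-sure termination. -/
lemma exists_ranking_certificate {T : Set S} (hT : ∀ s, pathMeasure P s (avoid T) = 0) :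
    ∃ (W : S → ℝ≥0) (δ : ℝ≥0 → ℝ≥0), Antitone δ ∧ (∀ r, 0 < δ r ∧ δ r ≤ 1) ∧
      (∀ s ∈ T, W s = 0) ∧ (∀ s ∉ T, 0 < W s) ∧ (∀ s, postExp P W s ≠ ∞) ∧
      (∀ s ∉ T, postExp P W s ≤ W s) ∧
      ∀ s ∉ T, (δ (W s) : ℝ≥0∞) ≤ P s {t | W t + δ (W s) ≤ W s} := by
  obtain ⟨f, hf⟩ := exists_injective_nat S
  obtain ⟨n, hn⟩ := exists_seq_escapes_small P hT hf
  have htop : ∀ s, ranking P T f n s ≠ ∞ := fun s =>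
    ranking_ne_top P fun k hk => (hn k s hk).1
  have hptop : ∀ s, ∫⁻ t, ranking P T f n t ∂(P s) ≠ ∞ := fun s =>
    lintegral_ranking_ne_top P fun k hk => (hn k s hk).2
  set W : S → ℝ≥0 := fun s => (ranking P T f n s).toNNReal with hWdef
  have hW : ∀ s, (W s : ℝ≥0∞) = ranking P T f n s := fun s => ENNReal.coe_toNNReal (htop s)
  have hpost : ∀ s, postExp P W s = ∫⁻ t, ranking P T f n t ∂(P s) := fun s => by
    simp only [postExp, hW]
  have hlt : ∀ s ∉ T, postExp P W s < W s := fun s hs => by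
    rw [hpost, hW]
    exact lintegral_ranking_lt P hT hs (hptop s)
  have hfin : ∀ r, {s | s ∉ T ∧ W s ≤ r}.Finite := fun r => by
    refine (finite_ranking_le P (T := T) hf n r).subset fun s hs => ⟨hs.1, ?_⟩
    rw [← hW]
    exact ENNReal.coe_le_coe.2 hs.2
  obtain ⟨δ, hanti, hδ, hdec⟩ := exists_uniform_rate P hfin fun s hs =>
    exists_decrease_of_lintegral_lt P (hlt s hs)
  refine ⟨W, δ, hanti, hδ, fun s hs => ?_, fun s hs => ?_, fun s => ?_,
    fun s hs => (hlt s hs).le, hdec⟩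
  · simp [hWdef, ranking_of_mem P f n hs]
  · exact ENNReal.coe_pos.1 (bot_le.trans_lt (hlt s hs))
  · rw [hpost]
    exact hptop s

end Termination

/-! ### Shift-invariance of the Streett event and assembly of the certificates -/

section Completeness

set_option linter.unusedSectionVars false

variable {S : Type*} [Countable S] [MeasurableSpace S] [DiscreteMeasurableSpace S]
variable (P : Kernel S S) [IsMarkovKernel P]

/-- The trajectories satisfying the Streett acceptance condition. -/
def streettSet {k : ℕ} (A B : Fin k → Set S) : Set (ℕ → S) :=
  reactivity (fun n (ω : ℕ → S) => ω n) A B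

lemma measurableSet_streettSet {k : ℕ} (A B : Fin k → Set S) :
    MeasurableSet (streettSet A B) := by
  refine .iInter fun i => .union ?_ ?_
  · exact .iUnion fun n => .iInter fun m => .iInter fun _ => measurableSet_eval m (A i)ᶜ
  · exact .iInter fun n => .iUnion fun m => .iUnion fun _ => measurableSet_eval m (B i)

lemma shiftSeq_mem_finVisits (A : Set S) (ω : ℕ → S) :
    shiftSeq ω ∈ finVisits (fun n (ω : ℕ → S) => ω n) A ↔
      ω ∈ finVisits (fun n (ω : ℕ → S) => ω n) A := by
  simp only [finVisits, Set.mem_iUnion, Set.mem_iInter, Set.mem_ofPred_eq, shiftSeq]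
  constructor
  · rintro ⟨n, hn⟩
    refine ⟨n + 1, fun m hm => ?_⟩
    obtain ⟨m, rfl⟩ : ∃ l, m = l + 1 := ⟨m - 1, by omega⟩
    exact hn m (by omega)
  · rintro ⟨n, hn⟩
    exact ⟨n, fun m hm => hn (m + 1) (by omega)⟩

lemma infVisits_eq_compl {Ω : Type*} (Φ : ℕ → Ω → S) (B : Set S) :
    infVisits Φ B = (finVisits Φ B)ᶜ := by
  ext ω
  simp [infVisits, finVisits]

/-- Acceptance depends only on the tail of the path; this is what makes `V₀` a supermartingale. -/
lemma shiftSeq_mem_streettSet {k : ℕ} (A B : Fin k → Set S) (ω : ℕ → S) :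
    shiftSeq ω ∈ streettSet A B ↔ ω ∈ streettSet A B := by
  simp only [streettSet, reactivity, infVisits_eq_compl, Set.mem_iInter, Set.mem_union,
    Set.mem_compl_iff, shiftSeq_mem_finVisits]

lemma pathMeasure_hits_of_mem {A : Set S} {s : S} (hs : s ∈ A) :
    pathMeasure P s (hits A) = 1 :=
  pathMeasure_eq_one_of_start P s fun ω h0 => ⟨0, by rwa [h0]⟩

lemma lintegral_hits_le (A : Set S) (s : S) :
    ∫⁻ t, pathMeasure P t (hits A) ∂(P s) ≤ pathMeasure P s (hits A) :=
  lintegral_pathMeasure_le P s (measurableSet_hits A) fun _ _ ⟨n, hn⟩ => ⟨n + 1, hn⟩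

end Completeness

theorem mainTheorem11 {S Ω : Type*} [Countable S] [MeasurableSpace S] [DiscreteMeasurableSpace S]
    [MeasurableSpace Ω] (μ : Measure S) [IsProbabilityMeasure μ]
    (P : Kernel S S) [IsMarkovKernel P] (Pr : Measure Ω) [IsProbabilityMeasure Pr]
    (Φ : ℕ → Ω → S) (hΦ : IsHomogeneousMarkovChain μ P Pr Φ)
    (k : ℕ) (A B : Fin k → Set S) (p : ℝ) (hp : p ∈ Set.Ioc (0 : ℝ) 1)
    (hreact : Pr (reactivity Φ A B) = ENNReal.ofReal p) (ε : ℝ) (hε : 0 < ε) :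
    ∃ (I : Set S) (V₀ : S → ℝ≥0) (J : Fin k → Set S) (V W : Fin k → S → ℝ≥0)
      (d q : Fin k → ℝ≥0 → ℝ),
      ProofRule2 P A B I V₀ J V W d q ∧ initExp μ V₀ ≤ ENNReal.ofReal (1 - p + ε) := by
  set E : Set (ℕ → S) := streettSet A B with hEdef
  have hEm : MeasurableSet E := measurableSet_streettSet A B
  -- The slack `ε` is spent here: scaling by `c > 1` keeps failure probabilities on `I` uniformly
  -- away from `1`.
  set c : ℝ≥0 := 1 + ε.toNNReal with hc
  have hc1 : 1 < c := by simpa [hc] using hε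
  have hc0 : c ≠ 0 := (one_pos.trans hc1).ne'
  set V₀ : S → ℝ≥0 := fun s => c * (pathMeasure P s Eᶜ).toNNReal with hV₀
  have hV₀c : ∀ s, (V₀ s : ℝ≥0∞) = c * pathMeasure P s Eᶜ := fun s => by
    rw [hV₀, ENNReal.coe_mul, ENNReal.coe_toNNReal (measure_ne_top _ _)]
  have hpost₀ : ∀ s, postExp P V₀ s = c * ∫⁻ t, pathMeasure P t Eᶜ ∂(P s) := fun s => by
    simp only [postExp, hV₀c]
    exact lintegral_const_mul _ Measurable.of_discrete
  set V : Fin k → S → ℝ≥0 := fun i s => (pathMeasure P s (hits (A i))).toNNReal with hV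
  have hVc : ∀ i s, (V i s : ℝ≥0∞) = pathMeasure P s (hits (A i)) := fun i s =>
    ENNReal.coe_toNNReal (measure_ne_top _ _)
  have hpostV : ∀ i s, postExp P (V i) s = ∫⁻ t, pathMeasure P t (hits (A i)) ∂(P s) :=
    fun i s => by simp only [postExp, hVc]
  set I : Set S := {s | V₀ s < 1} with hI
  set J : Fin k → Set S := fun i => {s | s ∈ I ∧ V i s ≤ 2⁻¹} with hJ
  have hVA : ∀ i, ∀ s ∈ A i, V i s = 1 := fun i s hs => by
    simp [hV, pathMeasure_hits_of_mem P hs]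
  -- Leaving `I` counts as termination, so the bounds valid on `I` suffice for every state outside
  -- `T i`.
  set T : Fin k → Set S := fun i => Iᶜ ∪ (B i ∪ J i) with hT
  have hTnull : ∀ i s, pathMeasure P s (avoid (T i)) = 0 := fun i => by
    refine pathMeasure_avoid_eq_zero_of_streett P (A := A i) (B := B i) (E := E)
      (θ := (c : ℝ≥0∞)⁻¹) (ENNReal.inv_lt_one.2 (by exact_mod_cast hc1))
      (fun s hs => Or.inr (Or.inl hs)) (fun s hs => ?_) (Set.iInter_subset _ i) fun s hs => ?_
    · have hsI : s ∈ I := by_contra fun h => hs (Or.inl h)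
      have hlt : (c : ℝ≥0∞) * pathMeasure P s Eᶜ ≤ 1 := by
        rw [← hV₀c]
        exact_mod_cast (show V₀ s < 1 from hsI).le
      rw [← one_div, ENNReal.le_div_iff_mul_le (Or.inr one_ne_zero) (Or.inr ENNReal.one_ne_top),
        mul_comm]
      exact hlt
    · have hsI : s ∈ I := by_contra fun h => hs (Or.inl h)
      have hlt : 2⁻¹ < V i s := lt_of_not_ge fun h => hs (Or.inr (Or.inr ⟨hsI, h⟩))
      rw [← hVc, show (2⁻¹ : ℝ≥0∞) = ((2⁻¹ : ℝ≥0) : ℝ≥0∞) by simp]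
      exact ENNReal.coe_le_coe.2 hlt.le
  choose W δ hanti hδ hW0 hWpos hWtop hWle hdec using
    fun i => exists_ranking_certificate P (hTnull i)
  have hTc : ∀ i, ∀ s ∈ I \ (B i ∪ J i), s ∉ T i := fun i s hs h =>
    h.elim (fun h => h hs.1) hs.2
  refine ⟨I, V₀, J, V, W, fun i r => δ i r, fun i r => δ i r, ?_, ?_⟩
  · constructor
    case absorbing_subset =>
      intro i s hs
      refine ⟨hs.1, fun hA => ?_⟩
      have h2 : V i s ≤ 2⁻¹ := hs.2
      rw [hVA i s hA] at h2
      exact absurd h2 (not_le.2 (by norm_num [inv_lt_one_iff₀]))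
    case d_pos => exact fun i r => (hδ i r).1
    case p_pos => exact fun i r => (hδ i r).1
    case p_le_one => exact fun i r => (hδ i r).2
    case post_V₀_ne_top =>
      intro s
      rw [hpost₀]
      exact ENNReal.mul_ne_top ENNReal.coe_ne_top
        ((lintegral_pathMeasure_le_one P s _).trans_lt ENNReal.one_lt_top).ne
    case post_V_ne_top =>
      intro i s
      rw [hpostV]
      exact ((lintegral_pathMeasure_le_one P s _).trans_lt ENNReal.one_lt_top).ne
    case post_W_ne_top => exact hWtop
    case post_V_le =>
      intro i s _
      rw [hpostV, hVc]
      exact lintegral_hits_le P (A i) s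
    case one_le_V => exact fun i s hs => (hVA i s hs).ge
    case V_le =>
      refine fun i => ⟨1 / 2, by norm_num, fun s hs => ?_⟩
      have h2 : (V i s : ℝ) ≤ ((2⁻¹ : ℝ≥0) : ℝ) := NNReal.coe_le_coe.2 hs.2
      refine h2.trans ?_
      norm_num
    case W_pos => exact fun i s hs => hWpos i s (hTc i s hs)
    case W_eq_zero => exact fun i s hs => hW0 i s (Or.inr hs.2)
    case post_W_le => exact fun i s hs => hWle i s (hTc i s hs)
    case progress =>
      rintro i _ _ s hs rfl
      rw [ENNReal.ofReal_coe_nnreal]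
      refine (hdec i s (hTc i s hs)).trans (measure_mono fun t ht => ?_)
      have : ((W i t + δ i (W i s) : ℝ≥0) : ℝ) ≤ W i s := NNReal.coe_le_coe.2 ht
      rw [NNReal.coe_add] at this
      exact le_sub_iff_add_le.2 this
    case p_antitone => exact fun i r₁ r₂ _ _ h => hanti i h
    case d_antitone => exact fun i r₁ r₂ _ _ h => hanti i h
    case post_V₀_le =>
      intro s _
      rw [hpost₀, hV₀c]
      gcongr
      exact lintegral_pathMeasure_le P s hEm.compl fun ω _ h hω =>
        h ((shiftSeq_mem_streettSet A B ω).2 hω)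
    case one_le_V₀ => exact fun s hs => not_lt.1 hs
  · have hlaw : ∫⁻ s, pathMeasure P s Eᶜ ∂μ = 1 - ENNReal.ofReal p := by
      have hEr : {ω | (fun n => Φ n ω) ∈ E} = reactivity Φ A B := by
        ext ω
        simp [hEdef, streettSet, reactivity, finVisits, infVisits]
      have hm : Measurable fun ω n => Φ n ω := measurable_pi_iff.2 hΦ.measurable
      rw [← hΦ.law_eq P hEm.compl, ← hreact, ← hEr]
      exact prob_compl_eq_one_sub (hm hEm)
    have hinit : initExp μ V₀ = c * (1 - ENNReal.ofReal p) := by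
      simp only [initExp, hV₀c]
      rw [lintegral_const_mul _ Measurable.of_discrete, hlaw]
    rw [hinit, ← ENNReal.ofReal_one, ← ENNReal.ofReal_sub _ hp.1.le, ← ENNReal.ofReal_coe_nnreal,
      ← ENNReal.ofReal_mul (NNReal.coe_nonneg _)]
    refine ENNReal.ofReal_le_ofReal ?_
    rw [hc, NNReal.coe_add, NNReal.coe_one, Real.coe_toNNReal _ hε.le]
    -- `(1 + ε) * (1 - p) = 1 - p + ε - ε * p`.
    nlinarith [mul_pos hε hp.1]
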